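/- Let $m,p,N\in\mathbb{N}$, let $\sigma>0$, and let $\mathcal{D}$ be the set of matrices in $\mathbb{R}^{m\times p}$ all of whose columns have Euclidean norm $1$. Fix $\mathbf{D}_0\in\mathcal{D}$ and a radius $0<r\le 2\sqrt{p}$, and put $\mathcal{X}(\mathbf{D}_0,r)=\{\mathbf{D}\in\mathcal{D}:\|\mathbf{D}-\mathbf{D}_0\|_{\rm F}<r\}$, where $\|\mathbf{A}\|_{\rm F}=\sqrt{\operatorname{tr}(\mathbf{A}\mathbf{A}^{T})}$. Let $P_x$ be a probability distribution on $\mathbb{R}^p$ with mean zero and finite second moments, and let $\mathbf{\Sigma}_x=\mathrm{E}\{\mathbf{x}\mathbf{x}^T\}$ for $\mathbf{x}\sim P_x$. For $\mathbf{D}\in\mathcal{X}(\mathbf{D}_0,r)$, the data $\mathbf{Y}=(\mathbf{y}_1,\dots,\mathbf{y}_N)$ consist of $N$ i.i.d. copies of $\mathbf{y}=\mathbf{D}\mathbf{x}+\mathbf{n}$, where $\mathbf{x}\sim P_x$ and the noise $\mathbf{n}\sim\mathcal{N}(\mathbf{0},\sigma^2\mathbf{I}_m)$ is independent of $\mathbf{x}$.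 Define the minimax risk $$\varepsilon^*=\inf_{\widehat{\mathbf{D}}}\ \sup_{\mathbf{D}\in\mathcal{X}(\mathbf{D}_0,r)}\mathrm{E}_{\mathbf{Y}}\big\{\|\widehat{\mathbf{D}}(\mathbf{Y})-\mathbf{D}\|_{\rm F}^2\big\},$$ where the infimum is over all measurable maps $\widehat{\mathbf{D}}:(\mathbb{R}^m)^N\to\mathbb{R}^{m\times p}$. If $p(m-1)\ge 50$, then $$\varepsilon^*\ \ge\ \frac{1}{320}\min\Big\{r^2,\ \frac{\sigma^2}{N\|\mathbf{\Sigma}_x\|_2}\Big(\frac{p(m-1)}{10}-1\Big)\Big\},$$ where $\|\cdot\|_2$ is the spectral norm and the second term of the minimum is read as $+\infty$ if $N\|\mathbf{\Sigma}_x\|_2=0$. -/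

import Mathlib

namespace DictLearn

open MeasureTheory ProbabilityTheory
open scoped ENNReal Matrix

/-- The Frobenius norm `‖A‖_F = √(tr (A Aᵀ))`. -/
noncomputable def frobNorm {m p : ℕ} (A : Matrix (Fin m) (Fin p) ℝ) : ℝ :=
  √(Matrix.trace (A * Aᵀ))

/-- The spectral norm `‖A‖₂`: the operator norm with respect to the Euclidean norm. -/
noncomputable def specNorm {p : ℕ} (A : Matrix (Fin p) (Fin p) ℝ) : ℝ :=
  ‖Matrix.toEuclideanCLM (n := Fin p) (𝕜 := ℝ) A‖

/-- The dictionaries: the `m × p` matrices all of whose columns have Euclidean norm one. -/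
def dictionaries (m p : ℕ) : Set (Matrix (Fin m) (Fin p) ℝ) :=
  {B | ∀ k, (Bᵀ * B) k k = 1}

/-- The dictionaries at Frobenius distance less than `r` from `D₀`. -/
def localDictionaries {m p : ℕ} (D₀ : Matrix (Fin m) (Fin p) ℝ) (r : ℝ) :
    Set (Matrix (Fin m) (Fin p) ℝ) :=
  {D | D ∈ dictionaries m p ∧ frobNorm (D - D₀) < r}

/-- The covariance matrix `E[x xᵀ]` of a zero-mean random vector `x` with law `P`. -/
noncomputable def covMat {p : ℕ} (P : Measure (Fin p → ℝ)) : Matrix (Fin p) (Fin p) ℝ :=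
  Matrix.of fun i j => ∫ x, x i * x j ∂P

/-- White Gaussian noise in `ℝᵐ`: independent coordinates with law `N(0, σ²)`. -/
noncomputable def whiteNoise (m : ℕ) (σ : ℝ) : Measure (Fin m → ℝ) :=
  Measure.pi fun _ => gaussianReal 0 (Real.toNNReal (σ ^ 2))

/-- The law of one observation `y = D x + n`, where `x ∼ P` and the white Gaussian noise `n` are
independent. -/
noncomputable def obsLaw {m p : ℕ} (P : Measure (Fin p → ℝ)) (σ : ℝ)
    (D : Matrix (Fin m) (Fin p) ℝ) : Measure (Fin m → ℝ) :=
  (P.prod (whiteNoise m σ)).map fun xn => D *ᵥ xn.1 + xn.2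

/-- The law of the data `Y = (y₁, …, y_N)`: `N` i.i.d. observations. -/
noncomputable def dataLaw {m p : ℕ} (N : ℕ) (P : Measure (Fin p → ℝ)) (σ : ℝ)
    (D : Matrix (Fin m) (Fin p) ℝ) : Measure (Fin N → Fin m → ℝ) :=
  Measure.pi fun _ => obsLaw P σ D

/-- The mean squared error `E ‖Dhat(Y) - D‖_F²` when `D` is the true dictionary. -/
noncomputable def mse {m p : ℕ} (N : ℕ) (P : Measure (Fin p → ℝ)) (σ : ℝ)
    (Dhat : (Fin N → Fin m → ℝ) → Matrix (Fin m) (Fin p) ℝ)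
    (D : Matrix (Fin m) (Fin p) ℝ) : ℝ≥0∞ :=
  ∫⁻ Y, ENNReal.ofReal (frobNorm (Dhat Y - D) ^ 2) ∂(dataLaw N P σ D)

/-- The minimax risk: the infimum over all (measurable) estimators of the worst-case mean squared
error over the dictionaries at distance less than `r` from `D₀`. -/
noncomputable def minimaxRisk {m p : ℕ} (N : ℕ) (P : Measure (Fin p → ℝ)) (σ : ℝ)
    (D₀ : Matrix (Fin m) (Fin p) ℝ) (r : ℝ) : ℝ≥0∞ :=
  ⨅ (Dhat : (Fin N → Fin m → ℝ) → Matrix (Fin m) (Fin p) ℝ)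
    (_ : ∀ i j, Measurable fun Y => Dhat Y i j),
    ⨆ D ∈ localDictionaries D₀ r, mse N P σ Dhat D

end DictLearn

/-!
Expand the `k`-th column of a dictionary in an orthonormal basis whose first vector is the `k`-th
column of `D₀`. Giving the other `n = m - 1` coordinates of every column the values `± a` and
normalizing yields a hypercube of dictionaries near `D₀`, whose neighbouring vertices differ by
`2 a` in one coordinate. By Assouad's argument, the risk of an estimator, averaged over the
hypercube, is at least the sum over the `p n` coordinates of what not telling two neighbouring
vertices apart costs.

That cost is bounded below by the Hellinger affinity of the two laws of the data, through the
triangle inequality and the Cauchy-Schwarz inequality. Given the coefficients, the data are Gaussian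
with means at squared distance `q`, so that the squared affinity is `exp (-q / 4σ²) ≥ 1 - q / 4σ²`;
averaging over the coefficients gives `E q ≤ 4 a² N ‖Σ‖₂`. Hence the risk is at least `p n a² / 2`
as soon as `4 p n a² ≤ r²` and `2 a² N ‖Σ‖₂ ≤ σ²`.
-/

namespace DictLearn

open MeasureTheory ProbabilityTheory
open scoped ENNReal Matrix

section Affinity

variable {Ω : Type*} [MeasurableSpace Ω] {μ : Measure Ω} {f g : Ω → ℝ≥0∞}

/-- The Hellinger affinity `∫ √(f g) dμ` of the measures with densities `f` and `g` with respect
to `μ`. It measures how hard the two are to tell apart. -/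
noncomputable def affinity (μ : Measure Ω) (f g : Ω → ℝ≥0∞) : ℝ≥0∞ :=
  ∫⁻ x, (f x * g x) ^ (1 / 2 : ℝ) ∂μ

lemma sq_lintegral_mul_sqrt_le (hf : Measurable f) (hg : Measurable g) {h : Ω → ℝ≥0∞}
    (hh : Measurable h) :
    (∫⁻ x, h x * (f x * g x) ^ (1 / 2 : ℝ) ∂μ) ^ 2 ≤
      (∫⁻ x, h x ^ 2 ∂(μ.withDensity f)) * ∫⁻ x, g x ∂μ := by
  have hsqrt : ∀ t : ℝ≥0∞, (t ^ (1 / 2 : ℝ)) ^ 2 = t := fun t => by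
    rw [← ENNReal.rpow_two, ← ENNReal.rpow_mul]; norm_num
  have holder := ENNReal.lintegral_mul_le_Lp_mul_Lq μ Real.HolderConjugate.two_two
    (f := fun x => h x * f x ^ (1 / 2 : ℝ)) (g := fun x => g x ^ (1 / 2 : ℝ))
    (by fun_prop) (by fun_prop)
  calc (∫⁻ x, h x * (f x * g x) ^ (1 / 2 : ℝ) ∂μ) ^ 2
      ≤ ((∫⁻ x, h x ^ 2 * f x ∂μ) ^ (1 / 2 : ℝ) * (∫⁻ x, g x ∂μ) ^ (1 / 2 : ℝ)) ^ 2 := by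
        gcongr
        simpa only [Pi.mul_apply, ENNReal.rpow_two, mul_pow, hsqrt, mul_assoc,
          ENNReal.mul_rpow_of_nonneg _ _ one_half_pos.le] using holder
    _ = (∫⁻ x, h x ^ 2 ∂(μ.withDensity f)) * ∫⁻ x, g x ∂μ := by
        rw [mul_pow, hsqrt, hsqrt, lintegral_withDensity_eq_lintegral_mul _ hf (by fun_prop)]
        simp only [Pi.mul_apply, mul_comm]

lemma sq_edist_mul_affinity_le {E : Type*} [PseudoEMetricSpace E] [MeasurableSpace E]
    [OpensMeasurableSpace E] (hf : Measurable f) (hg : Measurable g) (hf1 : ∫⁻ x, f x ∂μ ≤ 1)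
    (hg1 : ∫⁻ x, g x ∂μ ≤ 1) {T : Ω → E} (hT : Measurable T) (s s' : E) :
    (edist s s' * affinity μ f g) ^ 2 ≤
      2 * (∫⁻ x, edist (T x) s ^ 2 ∂(μ.withDensity f) +
        ∫⁻ x, edist (T x) s' ^ 2 ∂(μ.withDensity g)) := by
  have hdist : ∀ t, Measurable fun x => edist (T x) t := fun t => measurable_edist_left.comp hT
  set I := ∫⁻ x, edist (T x) s * (f x * g x) ^ (1 / 2 : ℝ) ∂μ
  set I' := ∫⁻ x, edist (T x) s' * (g x * f x) ^ (1 / 2 : ℝ) ∂μ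
  have hI : I ^ 2 ≤ ∫⁻ x, edist (T x) s ^ 2 ∂(μ.withDensity f) :=
    (sq_lintegral_mul_sqrt_le hf hg (hdist s)).trans (mul_le_of_le_one_right' hg1)
  have hI' : I' ^ 2 ≤ ∫⁻ x, edist (T x) s' ^ 2 ∂(μ.withDensity g) :=
    (sq_lintegral_mul_sqrt_le hg hf (hdist s')).trans (mul_le_of_le_one_right' hf1)
  have htriangle : edist s s' * affinity μ f g ≤ I + I' := by
    rw [affinity, ← lintegral_const_mul _ (by fun_prop), ← lintegral_add_left (by fun_prop)]
    refine lintegral_mono fun x => ?_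
    rw [mul_comm (g x), ← add_mul]
    gcongr
    exact edist_triangle_left s s' (T x)
  calc (edist s s' * affinity μ f g) ^ 2 ≤ (I + I') ^ 2 := by gcongr
    _ ≤ 2 * (I ^ 2 + I' ^ 2) := by
        have h := ENNReal.rpow_add_le_mul_rpow_add_rpow I I' (one_le_two (α := ℝ))
        norm_num at h
        exact h
    _ ≤ _ := by gcongr

end Affinity

section Product

lemma indicator_univ_pi_prod {ι : Type*} [Fintype ι] {E : ι → Type*} (f : ∀ i, E i → ℝ≥0∞)
    (s : ∀ i, Set (E i)) (x : ∀ i, E i) :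
    (Set.univ.pi s).indicator (fun x => ∏ i, f i (x i)) x = ∏ i, (s i).indicator (f i) (x i) := by
  by_cases hx : x ∈ Set.univ.pi s
  · rw [Set.indicator_of_mem hx]
    exact Finset.prod_congr rfl fun i _ =>
      (Set.indicator_of_mem (hx i (Set.mem_univ i)) _).symm
  · rw [Set.indicator_of_notMem hx]
    simp only [Set.mem_pi, Set.mem_univ, forall_const, not_forall] at hx
    obtain ⟨i, hi⟩ := hx
    exact (Finset.prod_eq_zero (Finset.mem_univ i) (Set.indicator_of_notMem hi _)).symm

variable {ι : Type*} [Fintype ι] {E : ι → Type*} [∀ i, MeasurableSpace (E i)]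
  {ν : ∀ i, Measure (E i)} [∀ i, IsProbabilityMeasure (ν i)] {f : ∀ i, E i → ℝ≥0∞}

lemma lintegral_pi_prod_eq_prod_lintegral (hf : ∀ i, Measurable (f i)) :
    ∫⁻ x, ∏ i, f i (x i) ∂(Measure.pi ν) = ∏ i, ∫⁻ x, f i x ∂(ν i) := by
  rw [lintegral_prod_eq_prod_lintegral_of_indepFun Finset.univ (fun i (x : ∀ i, E i) => f i (x i))
    (iIndepFun_pi fun i => (hf i).aemeasurable) fun i => (hf i).comp (measurable_pi_apply i)]
  exact Finset.prod_congr rfl fun i _ => (measurePreserving_eval ν i).lintegral_comp (hf i)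

lemma pi_withDensity (hf : ∀ i, Measurable (f i)) [∀ i, SigmaFinite ((ν i).withDensity (f i))] :
    Measure.pi (fun i => (ν i).withDensity (f i)) =
      (Measure.pi ν).withDensity fun x => ∏ i, f i (x i) := by
  refine Measure.pi_eq fun s hs => ?_
  rw [withDensity_apply _ (MeasurableSet.univ_pi hs),
    ← lintegral_indicator (MeasurableSet.univ_pi hs)]
  simp_rw [indicator_univ_pi_prod]
  rw [lintegral_pi_prod_eq_prod_lintegral fun i => (hf i).indicator (hs i)]
  exact Finset.prod_congr rfl fun i _ => by
    rw [lintegral_indicator (hs i), withDensity_apply _ (hs i)]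

lemma map_pi_eq_withDensity {F : ι → Type*} [∀ i, MeasurableSpace (F i)] {μ : ∀ i, Measure (F i)}
    [∀ i, IsProbabilityMeasure (μ i)] {φ : ∀ i, F i → E i} (hφ : ∀ i, Measurable (φ i))
    (hf : ∀ i, Measurable (f i)) (h : ∀ i, (μ i).map (φ i) = (ν i).withDensity (f i)) :
    (Measure.pi μ).map (fun x i => φ i (x i)) =
      (Measure.pi ν).withDensity fun x => ∏ i, f i (x i) := by
  have hmap : ∀ i, IsProbabilityMeasure ((μ i).map (φ i)) := fun i =>
    Measure.isProbabilityMeasure_map (hφ i).aemeasurable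
  have hdens : ∀ i, IsProbabilityMeasure ((ν i).withDensity (f i)) := fun i => h i ▸ hmap i
  rw [← pi_withDensity hf, ← funext h]
  exact Measure.pi_map_pi fun i => (hφ i).aemeasurable

end Product

section GaussianShift

variable {N m : ℕ} {σ : ℝ}

/-- The density at `y` of `N(c, σ²)` with respect to `N(0, σ²)`. -/
noncomputable def gaussianTilt (σ c y : ℝ) : ℝ≥0∞ :=
  ENNReal.ofReal (Real.exp ((c * y - c ^ 2 / 2) / σ ^ 2))

@[fun_prop]
lemma measurable_gaussianTilt (σ c : ℝ) : Measurable (gaussianTilt σ c) := by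
  unfold gaussianTilt; fun_prop

lemma gaussianReal_map_const_add_eq_withDensity (hσ : σ ≠ 0) (c : ℝ) :
    (gaussianReal 0 (σ ^ 2).toNNReal).map (c + ·) =
      (gaussianReal 0 (σ ^ 2).toNNReal).withDensity (gaussianTilt σ c) := by
  have hv : (σ ^ 2).toNNReal ≠ 0 := by
    rw [Ne, Real.toNNReal_eq_zero, not_le]; positivity
  rw [gaussianReal_map_const_add, gaussianReal_of_var_ne_zero _ hv,
    gaussianReal_of_var_ne_zero _ hv,
    ← withDensity_mul _ (measurable_gaussianPDF _ _) (by fun_prop)]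
  congr 1
  ext y
  rw [Pi.mul_apply, gaussianPDF, gaussianPDF, gaussianTilt,
    ← ENNReal.ofReal_mul (gaussianPDFReal_nonneg _ _ _)]
  congr 1
  rw [gaussianPDFReal, gaussianPDFReal, mul_assoc (√_)⁻¹, ← Real.exp_add,
    Real.coe_toNNReal _ (sq_nonneg σ)]
  congr 2
  field_simp
  ring

lemma sqrt_gaussianTilt_mul (σ c c' y : ℝ) :
    (gaussianTilt σ c y * gaussianTilt σ c' y) ^ (1 / 2 : ℝ) =
      ENNReal.ofReal (Real.exp (-(c - c') ^ 2 / (8 * σ ^ 2))) *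
        gaussianTilt σ ((c + c') / 2) y := by
  simp only [gaussianTilt]
  rw [← ENNReal.ofReal_mul (Real.exp_nonneg _), ← ENNReal.ofReal_mul (Real.exp_nonneg _),
    ENNReal.ofReal_rpow_of_nonneg (by positivity) one_half_pos.le, ← Real.exp_add, ← Real.exp_add,
    ← Real.exp_mul]
  congr 2
  ring

instance isProbabilityMeasure_whiteNoise (m : ℕ) (σ : ℝ) :
    IsProbabilityMeasure (whiteNoise m σ) := by
  unfold whiteNoise; infer_instance

/-- The law of the noise `(n₁, …, n_N)` in all `N` observations. -/
noncomputable def dataNoise (N m : ℕ) (σ : ℝ) : Measure (Fin N → Fin m → ℝ) :=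
  Measure.pi fun _ => whiteNoise m σ

instance isProbabilityMeasure_dataNoise (N m : ℕ) (σ : ℝ) :
    IsProbabilityMeasure (dataNoise N m σ) := by
  unfold dataNoise; infer_instance

/-- The density at `y` of the noise translated by `w`, with respect to the noise. -/
noncomputable def noiseTilt (σ : ℝ) (w y : Fin N → Fin m → ℝ) : ℝ≥0∞ :=
  ∏ i, ∏ l, gaussianTilt σ (w i l) (y i l)

@[fun_prop]
lemma measurable_noiseTilt (σ : ℝ) (w : Fin N → Fin m → ℝ) : Measurable (noiseTilt σ w) := by
  unfold noiseTilt; fun_prop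

lemma dataNoise_map_const_add (hσ : σ ≠ 0) (w : Fin N → Fin m → ℝ) :
    (dataNoise N m σ).map (w + ·) = (dataNoise N m σ).withDensity (noiseTilt σ w) := by
  have hrow : ∀ i, (whiteNoise m σ).map (w i + ·) = (whiteNoise m σ).withDensity
      fun y => ∏ l, gaussianTilt σ (w i l) (y l) := fun i =>
    map_pi_eq_withDensity (fun l => measurable_const_add (w i l)) (fun l => by fun_prop)
      fun l => gaussianReal_map_const_add_eq_withDensity hσ (w i l)
  have hdata := map_pi_eq_withDensity (fun i => measurable_const_add (w i))
    (fun i => by fun_prop) hrow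
  exact hdata

lemma lintegral_noiseTilt (hσ : σ ≠ 0) (w : Fin N → Fin m → ℝ) :
    ∫⁻ y, noiseTilt σ w y ∂(dataNoise N m σ) = 1 := by
  have hprob : IsProbabilityMeasure ((dataNoise N m σ).map (w + ·)) :=
    Measure.isProbabilityMeasure_map (measurable_const_add w).aemeasurable
  rw [← setLIntegral_univ, ← withDensity_apply _ MeasurableSet.univ, ← dataNoise_map_const_add hσ,
    measure_univ]

lemma affinity_noiseTilt (hσ : σ ≠ 0) (w w' : Fin N → Fin m → ℝ) :
    affinity (dataNoise N m σ) (noiseTilt σ w) (noiseTilt σ w') =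
      ENNReal.ofReal (Real.exp (-(∑ i, ∑ l, (w i l - w' i l) ^ 2) / (8 * σ ^ 2))) := by
  have hsqrt : ∀ y, (noiseTilt σ w y * noiseTilt σ w' y) ^ (1 / 2 : ℝ) =
      ENNReal.ofReal (Real.exp (-(∑ i, ∑ l, (w i l - w' i l) ^ 2) / (8 * σ ^ 2))) *
        noiseTilt σ (fun i l => (w i l + w' i l) / 2) y := by
    intro y
    simp only [noiseTilt, ← Finset.prod_mul_distrib,
      ← ENNReal.prod_rpow_of_nonneg one_half_pos.le, sqrt_gaussianTilt_mul,
      ← Finset.sum_neg_distrib, Finset.sum_div, Real.exp_sum,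
      ENNReal.ofReal_prod_of_nonneg fun _ _ => Real.exp_nonneg _,
      ENNReal.ofReal_prod_of_nonneg fun _ _ => Finset.prod_nonneg fun _ _ => Real.exp_nonneg _]
  simp only [affinity, hsqrt]
  rw [lintegral_const_mul _ (by fun_prop), lintegral_noiseTilt hσ, mul_one]

lemma two_point_dataNoise {E : Type*} [PseudoEMetricSpace E] [MeasurableSpace E]
    [OpensMeasurableSpace E] (hσ : σ ≠ 0) (w w' : Fin N → Fin m → ℝ)
    {T : (Fin N → Fin m → ℝ) → E} (hT : Measurable T) (s s' : E) :
    edist s s' ^ 2 *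
        ENNReal.ofReal (Real.exp (-((∑ i, ∑ l, (w i l - w' i l) ^ 2) / (4 * σ ^ 2)))) ≤
      2 * (∫⁻ y, edist (T (w + y)) s ^ 2 ∂(dataNoise N m σ) +
        ∫⁻ y, edist (T (w' + y)) s' ^ 2 ∂(dataNoise N m σ)) := by
  have hdist : ∀ t, Measurable fun y => edist (T y) t ^ 2 := fun t =>
    (measurable_edist_left.comp hT).pow_const 2
  have hrisk : ∀ v t, ∫⁻ y, edist (T (v + y)) t ^ 2 ∂(dataNoise N m σ) =
      ∫⁻ y, edist (T y) t ^ 2 ∂((dataNoise N m σ).withDensity (noiseTilt σ v)) := fun v t => by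
    rw [← dataNoise_map_const_add hσ, lintegral_map (hdist t) (measurable_const_add v)]
  have h := sq_edist_mul_affinity_le (measurable_noiseTilt σ w) (measurable_noiseTilt σ w')
    (lintegral_noiseTilt hσ w).le (lintegral_noiseTilt hσ w').le hT s s'
  rw [hrisk, hrisk]
  convert h using 1
  rw [affinity_noiseTilt hσ, mul_pow, ← ENNReal.ofReal_pow (Real.exp_nonneg _), ← Real.exp_nat_mul]
  congr 3
  push_cast
  ring

end GaussianShift

section SecondMoment

variable {m p : ℕ} {P : Measure (Fin p → ℝ)}

@[fun_prop]
lemma measurable_mulVec (D : Matrix (Fin m) (Fin p) ℝ) : Measurable (D *ᵥ ·) :=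
  (Continuous.matrix_mulVec continuous_const continuous_id).measurable

lemma integrable_mulVec_sq (hP2 : ∀ i, MemLp (fun x : Fin p → ℝ => x i) 2 P)
    (A : Matrix (Fin m) (Fin p) ℝ) (l : Fin m) : Integrable (fun x => (A *ᵥ x) l ^ 2) P :=
  (memLp_finsetSum Finset.univ fun j _ => (hP2 j).const_mul (A l j)).integrable_sq

lemma integral_sum_mulVec_sq (hP2 : ∀ i, MemLp (fun x : Fin p → ℝ => x i) 2 P)
    (A : Matrix (Fin m) (Fin p) ℝ) :
    ∫ x, ∑ l, (A *ᵥ x) l ^ 2 ∂P = (A * covMat P * Aᵀ).trace := by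
  have hint : ∀ l j i, Integrable (fun x : Fin p → ℝ => A l i * (x i * x j) * A l j) P :=
    fun l j i => (((hP2 i).integrable_mul (hP2 j)).const_mul _).mul_const _
  have hexpand : ∀ (x : Fin p → ℝ) l,
      (A *ᵥ x) l ^ 2 = ∑ j, ∑ i, A l i * (x i * x j) * A l j := by
    intro x l
    simp only [Matrix.mulVec, dotProduct, sq]
    rw [Finset.sum_mul_sum, Finset.sum_comm]
    exact Finset.sum_congr rfl fun j _ => Finset.sum_congr rfl fun i _ => by ring
  have hterm : ∀ l j i, ∫ x, A l i * (x i * x j) * A l j ∂P = A l i * covMat P i j * A l j :=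
    fun l j i => by rw [integral_mul_const, integral_const_mul]; rfl
  simp only [Matrix.trace, Matrix.diag, Matrix.mul_apply, Matrix.transpose_apply, Finset.sum_mul]
  rw [integral_finsetSum _ fun l _ => integrable_mulVec_sq hP2 A l]
  refine Finset.sum_congr rfl fun l _ => ?_
  simp only [hexpand]
  rw [integral_finsetSum _ fun j _ => integrable_finsetSum _ fun i _ => hint l j i]
  refine Finset.sum_congr rfl fun j _ => ?_
  rw [integral_finsetSum _ fun i _ => hint l j i]
  exact Finset.sum_congr rfl fun i _ => hterm l j i

lemma frobNorm_sq_eq_sum_sq (A : Matrix (Fin m) (Fin p) ℝ) :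
    frobNorm A ^ 2 = ∑ l, ∑ k, A l k ^ 2 := by
  have htrace : (A * Aᵀ).trace = ∑ l, ∑ k, A l k ^ 2 := by
    simp only [Matrix.trace, Matrix.diag, Matrix.mul_apply, Matrix.transpose_apply, sq]
  rw [frobNorm, htrace, Real.sq_sqrt (by positivity)]

lemma dotProduct_mulVec_self_le (S : Matrix (Fin p) (Fin p) ℝ) (v : Fin p → ℝ) :
    v ⬝ᵥ S *ᵥ v ≤ specNorm S * (v ⬝ᵥ v) := by
  set x : EuclideanSpace ℝ (Fin p) := WithLp.toLp 2 v
  calc v ⬝ᵥ S *ᵥ v = inner ℝ x (Matrix.toEuclideanCLM (n := Fin p) (𝕜 := ℝ) S x) := by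
        rw [Matrix.inner_toEuclideanCLM]
    _ ≤ ‖x‖ * (specNorm S * ‖x‖) :=
        (real_inner_le_norm _ _).trans (by gcongr; exact ContinuousLinearMap.le_opNorm _ _)
    _ = specNorm S * (v ⬝ᵥ v) := by
        rw [mul_left_comm, ← real_inner_self_eq_norm_mul_norm]; rfl

lemma trace_mul_mul_transpose_le (A : Matrix (Fin m) (Fin p) ℝ) (S : Matrix (Fin p) (Fin p) ℝ) :
    (A * S * Aᵀ).trace ≤ specNorm S * frobNorm A ^ 2 := by
  have hdiag : ∀ l, (A * S * Aᵀ) l l = A l ⬝ᵥ S *ᵥ A l := fun l => by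
    rw [Matrix.dotProduct_mulVec]; rfl
  rw [frobNorm_sq_eq_sum_sq, Finset.mul_sum]
  refine Finset.sum_le_sum fun l _ => ?_
  rw [Matrix.diag_apply, hdiag]
  simpa only [dotProduct, sq] using dotProduct_mulVec_self_le S (A l)

lemma lintegral_sum_mulVec_sq [IsProbabilityMeasure P]
    (hP2 : ∀ i, MemLp (fun x : Fin p → ℝ => x i) 2 P) (A : Matrix (Fin m) (Fin p) ℝ) (N : ℕ) :
    ∫⁻ X, ENNReal.ofReal (∑ i, ∑ l, (A *ᵥ X i) l ^ 2) ∂(Measure.pi fun _ : Fin N => P) =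
      ENNReal.ofReal (N * (A * covMat P * Aᵀ).trace) := by
  have hint : Integrable (fun x => ∑ l, (A *ᵥ x) l ^ 2) P :=
    integrable_finsetSum _ fun l _ => integrable_mulVec_sq hP2 A l
  have heval : ∀ i : Fin N, ∫⁻ X, ENNReal.ofReal (∑ l, (A *ᵥ X i) l ^ 2)
      ∂(Measure.pi fun _ : Fin N => P) = ENNReal.ofReal (A * covMat P * Aᵀ).trace := fun i => by
    rw [← integral_sum_mulVec_sq hP2, ofReal_integral_eq_lintegral_ofReal hint
      (.of_forall fun x => by positivity)]
    exact (measurePreserving_eval (fun _ => P) i).lintegral_comp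
      (f := fun x => ENNReal.ofReal (∑ l, (A *ᵥ x) l ^ 2)) (by fun_prop)
  simp only [ENNReal.ofReal_sum_of_nonneg fun _ _ => Finset.sum_nonneg fun _ _ => sq_nonneg _]
  rw [lintegral_finsetSum _ fun i _ => by fun_prop, Finset.sum_congr rfl fun i _ => heval i]
  simp [ENNReal.ofReal_mul]

end SecondMoment

section DataLaw

variable {m p N : ℕ} {P : Measure (Fin p → ℝ)} [IsProbabilityMeasure P]

lemma lintegral_dataLaw (σ : ℝ) (D : Matrix (Fin m) (Fin p) ℝ) {g : (Fin N → Fin m → ℝ) → ℝ≥0∞}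
    (hg : Measurable g) :
    ∫⁻ Y, g Y ∂(dataLaw N P σ D) =
      ∫⁻ X, ∫⁻ y, g ((fun i => D *ᵥ X i) + y) ∂(dataNoise N m σ)
        ∂(Measure.pi fun _ : Fin N => P) := by
  have hobs : Measurable fun xn : (Fin p → ℝ) × (Fin m → ℝ) => D *ᵥ xn.1 + xn.2 := by fun_prop
  have : IsProbabilityMeasure ((P.prod (whiteNoise m σ)).map fun xn => D *ᵥ xn.1 + xn.2) :=
    Measure.isProbabilityMeasure_map hobs.aemeasurable
  have hsplit := measurePreserving_arrowProdEquivProdArrow (Fin p → ℝ) (Fin m → ℝ) (Fin N)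
    (fun _ => P) (fun _ => whiteNoise m σ)
  have hg' : Measurable fun XY : (Fin N → Fin p → ℝ) × (Fin N → Fin m → ℝ) =>
      g ((fun i => D *ᵥ XY.1 i) + XY.2) := by fun_prop
  unfold dataLaw obsLaw
  rw [← Measure.pi_map_pi fun _ => hobs.aemeasurable, lintegral_map hg (by fun_prop), dataNoise,
    ← lintegral_prod _ hg'.aemeasurable]
  exact hsplit.lintegral_comp hg'

lemma one_sub_lintegral_le_lintegral_exp_neg {Ω : Type*} [MeasurableSpace Ω] (μ : Measure Ω)
    [IsProbabilityMeasure μ] {z : Ω → ℝ} (hz : Measurable z) :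
    1 - ∫⁻ x, ENNReal.ofReal (z x) ∂μ ≤ ∫⁻ x, ENNReal.ofReal (Real.exp (-z x)) ∂μ := by
  rw [tsub_le_iff_right, ← lintegral_add_left (by fun_prop)]
  calc (1 : ℝ≥0∞) = ∫⁻ _, 1 ∂μ := by simp
    _ ≤ ∫⁻ x, ENNReal.ofReal (Real.exp (-z x)) + ENNReal.ofReal (z x) ∂μ := by
        gcongr with x
        rw [← ENNReal.ofReal_one]
        refine (ENNReal.ofReal_le_ofReal ?_).trans ENNReal.ofReal_add_le
        linarith [Real.add_one_le_exp (-z x)]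

lemma half_le_lintegral_exp_neg (hP2 : ∀ i, MemLp (fun x : Fin p → ℝ => x i) 2 P) {σ : ℝ}
    (hσ : σ ≠ 0) {A : Matrix (Fin m) (Fin p) ℝ}
    (hA : N * specNorm (covMat P) * frobNorm A ^ 2 ≤ 2 * σ ^ 2) :
    1 / 2 ≤ ∫⁻ X, ENNReal.ofReal (Real.exp (-((∑ i, ∑ l, (A *ᵥ X i) l ^ 2) / (4 * σ ^ 2))))
      ∂(Measure.pi fun _ : Fin N => P) := by
  refine le_trans ?_ (one_sub_lintegral_le_lintegral_exp_neg _ (by fun_prop))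
  have hmean : ∫⁻ X, ENNReal.ofReal ((∑ i, ∑ l, (A *ᵥ X i) l ^ 2) / (4 * σ ^ 2))
      ∂(Measure.pi fun _ : Fin N => P) ≤ 1 / 2 := by
    have hc : 0 < 4 * σ ^ 2 := by positivity
    simp only [ENNReal.ofReal_div_of_pos hc, div_eq_mul_inv (ENNReal.ofReal _)]
    rw [lintegral_mul_const _ (by fun_prop), lintegral_sum_mulVec_sq hP2, ← div_eq_mul_inv,
      ← ENNReal.ofReal_div_of_pos hc, ← ENNReal.ofReal_ofNat 2, ← ENNReal.ofReal_one,
      ← ENNReal.ofReal_div_of_pos two_pos]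
    refine ENNReal.ofReal_le_ofReal ((div_le_div_iff₀ hc two_pos).2 ?_)
    have htrace : N * (A * covMat P * Aᵀ).trace ≤ N * (specNorm (covMat P) * frobNorm A ^ 2) := by
      gcongr
      exact trace_mul_mul_transpose_le A _
    linarith
  calc (1 / 2 : ℝ≥0∞) = 1 - 1 / 2 := by simp
    _ ≤ _ := tsub_le_tsub_left hmean 1

lemma two_point_dataLaw {E : Type*} [PseudoEMetricSpace E] [MeasurableSpace E]
    [OpensMeasurableSpace E] (hP2 : ∀ i, MemLp (fun x : Fin p → ℝ => x i) 2 P) {σ : ℝ}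
    (hσ : σ ≠ 0) {D D' : Matrix (Fin m) (Fin p) ℝ}
    (hD : N * specNorm (covMat P) * frobNorm (D - D') ^ 2 ≤ 2 * σ ^ 2)
    {T : (Fin N → Fin m → ℝ) → E} (hT : Measurable T) (s s' : E) :
    edist s s' ^ 2 ≤ 4 * (∫⁻ Y, edist (T Y) s ^ 2 ∂(dataLaw N P σ D) +
        ∫⁻ Y, edist (T Y) s' ^ 2 ∂(dataLaw N P σ D')) := by
  have hdist : ∀ t, Measurable fun y => edist (T y) t ^ 2 := fun t =>
    (measurable_edist_left.comp hT).pow_const 2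
  set R : Matrix (Fin m) (Fin p) ℝ → E → (Fin N → Fin p → ℝ) → ℝ≥0∞ := fun B t X =>
    ∫⁻ y, edist (T ((fun i => B *ᵥ X i) + y)) t ^ 2 ∂(dataNoise N m σ)
  have hR : ∀ B t, Measurable (R B t) := fun B t =>
    Measurable.lintegral_prod_right' (f := fun XY : (Fin N → Fin p → ℝ) × (Fin N → Fin m → ℝ) =>
      edist (T ((fun i => B *ᵥ XY.1 i) + XY.2)) t ^ 2) ((hdist t).comp (by fun_prop))
  set q : (Fin N → Fin p → ℝ) → ℝ := fun X =>
    (∑ i, ∑ l, ((D - D') *ᵥ X i) l ^ 2) / (4 * σ ^ 2) with hq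
  have hcond : ∀ X, edist s s' ^ 2 * ENNReal.ofReal (Real.exp (-q X)) ≤
      2 * (R D s X + R D' s' X) := fun X => by
    simpa only [hq, Matrix.sub_mulVec, Pi.sub_apply] using
      two_point_dataNoise hσ (fun i => D *ᵥ X i) (fun i => D' *ᵥ X i) hT s s'
  have hmean : edist s s' ^ 2 * (1 / 2) ≤
      2 * (∫⁻ Y, edist (T Y) s ^ 2 ∂(dataLaw N P σ D) +
        ∫⁻ Y, edist (T Y) s' ^ 2 ∂(dataLaw N P σ D')) := by
    calc edist s s' ^ 2 * (1 / 2)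
        ≤ edist s s' ^ 2 *
            ∫⁻ X, ENNReal.ofReal (Real.exp (-q X)) ∂(Measure.pi fun _ : Fin N => P) := by
          gcongr; exact half_le_lintegral_exp_neg hP2 hσ hD
      _ ≤ ∫⁻ X, 2 * (R D s X + R D' s' X) ∂(Measure.pi fun _ : Fin N => P) := by
          rw [← lintegral_const_mul _ (by fun_prop)]
          exact lintegral_mono hcond
      _ = _ := by
          rw [lintegral_const_mul _ (by fun_prop), lintegral_add_left (hR D s),
            lintegral_dataLaw σ D (hdist s), lintegral_dataLaw σ D' (hdist s')]
  calc edist s s' ^ 2 = 2 * (edist s s' ^ 2 * (1 / 2)) := by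
        rw [mul_left_comm, one_div, ENNReal.mul_inv_cancel two_ne_zero ENNReal.ofNat_ne_top,
          mul_one]
    _ ≤ 2 * (2 * _) := by gcongr
    _ = _ := by rw [← mul_assoc]; norm_num

end DataLaw

section Coordinates

variable {m p : ℕ} {ι : Type*} [Fintype ι]

/-- The coordinates of the columns of a matrix, the `k`-th column being expanded in the orthonormal
basis `b k`. -/
noncomputable def colCoord (b : Fin p → OrthonormalBasis ι ℝ (EuclideanSpace ℝ (Fin m))) :
    Matrix (Fin m) (Fin p) ℝ ≃ₗ[ℝ] (Fin p → ι → ℝ) :=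
  Matrix.transposeLinearEquiv (Fin m) (Fin p) ℝ ℝ ≪≫ₗ
    (Matrix.ofLinearEquiv ℝ).symm ≪≫ₗ
    LinearEquiv.piCongrRight fun k => (WithLp.linearEquiv 2 ℝ (Fin m → ℝ)).symm ≪≫ₗ
      (b k).repr.toLinearEquiv ≪≫ₗ WithLp.linearEquiv 2 ℝ (ι → ℝ)

variable (b : Fin p → OrthonormalBasis ι ℝ (EuclideanSpace ℝ (Fin m)))
  (A : Matrix (Fin m) (Fin p) ℝ)

lemma colCoord_apply (k : Fin p) (i : ι) :
    colCoord b A k i = (b k).repr (WithLp.toLp 2 (Aᵀ k)) i := rfl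

lemma colCoord_apply_eq_sum (k : Fin p) (i : ι) :
    colCoord b A k i = ∑ l, b k i l * A l k := by
  rw [colCoord_apply, OrthonormalBasis.repr_apply_apply, PiLp.inner_apply]
  exact Finset.sum_congr rfl fun l _ => mul_comm _ _

lemma sum_colCoord_sq (k : Fin p) : ∑ i, colCoord b A k i ^ 2 = ∑ l, A l k ^ 2 := by
  have h := (b k).repr.norm_map (WithLp.toLp 2 (Aᵀ k))
  simpa only [colCoord_apply, EuclideanSpace.norm_eq, Real.norm_eq_abs, sq_abs,
    Matrix.transpose_apply, Real.sqrt_inj (Finset.sum_nonneg fun _ _ => sq_nonneg _)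
      (Finset.sum_nonneg fun _ _ => sq_nonneg _)] using h

lemma frobNorm_sq_eq_sum_colCoord_sq :
    frobNorm A ^ 2 = ∑ k, ∑ i, colCoord b A k i ^ 2 := by
  simp only [sum_colCoord_sq]
  rw [frobNorm_sq_eq_sum_sq, Finset.sum_comm]

lemma mem_dictionaries_iff_sum_colCoord_sq :
    A ∈ dictionaries m p ↔ ∀ k, ∑ i, colCoord b A k i ^ 2 = 1 := by
  simp only [sum_colCoord_sq]
  simp only [dictionaries, Set.mem_ofPred_eq, Matrix.mul_apply, Matrix.transpose_apply, sq]

lemma exists_colCoord_eq_cons_one_zero {n : ℕ} {D₀ : Matrix (Fin (n + 1)) (Fin p) ℝ}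
    (hD₀ : D₀ ∈ dictionaries (n + 1) p) :
    ∃ b : Fin p → OrthonormalBasis (Fin (n + 1)) ℝ (EuclideanSpace ℝ (Fin (n + 1))),
      ∀ k, colCoord b D₀ k = Fin.cons 1 0 := by
  have hcol : ∀ k, ∃ b : OrthonormalBasis (Fin (n + 1)) ℝ (EuclideanSpace ℝ (Fin (n + 1))),
      b 0 = WithLp.toLp 2 (D₀ᵀ k) := fun k => by
    have hunit : Orthonormal ℝ (({0} : Set (Fin (n + 1))).domRestrict
        fun _ => WithLp.toLp 2 (D₀ᵀ k)) := by
      refine ⟨fun _ => ?_, fun i j hij => absurd (Subsingleton.elim i j) hij⟩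
      have hsq := (mem_dictionaries_iff_sum_colCoord_sq
        (fun _ => EuclideanSpace.basisFun (Fin (n + 1)) ℝ) D₀).1 hD₀ k
      simp only [sum_colCoord_sq] at hsq
      simp [EuclideanSpace.norm_eq, hsq]
    obtain ⟨b, hb⟩ := hunit.exists_orthonormalBasis_extension_of_card_eq (by simp)
    exact ⟨b, hb 0 rfl⟩
  choose b hb using hcol
  refine ⟨b, fun k => ?_⟩
  ext i
  rw [colCoord_apply, ← hb, OrthonormalBasis.repr_self]
  refine Fin.cases ?_ (fun j => ?_) i <;> simp

end Coordinates

section Hypercube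

variable {n p : ℕ} {a : ℝ}

/-- The vertex `θ` of a hypercube of dictionaries around the one whose columns are the vectors
`b k 0`: the coordinate `j + 1` of the column `k` is `± a`, the sign being given by the bit
`θ (k, j)`, and the coordinate `0` normalizes the column, provided that `n a² ≤ 1`. -/
noncomputable def cubeDictionary
    (b : Fin p → OrthonormalBasis (Fin (n + 1)) ℝ (EuclideanSpace ℝ (Fin (n + 1)))) (a : ℝ)
    (θ : Fin p × Fin n → Bool) : Matrix (Fin (n + 1)) (Fin p) ℝ :=
  (colCoord b).symm fun k => Fin.cons √(1 - n * a ^ 2) fun j => if θ (k, j) then a else -a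

variable (b : Fin p → OrthonormalBasis (Fin (n + 1)) ℝ (EuclideanSpace ℝ (Fin (n + 1))))

lemma colCoord_cubeDictionary (a : ℝ) (θ : Fin p × Fin n → Bool) (k : Fin p) :
    colCoord b (cubeDictionary b a θ) k =
      Fin.cons √(1 - n * a ^ 2) fun j => if θ (k, j) then a else -a := by
  rw [cubeDictionary, LinearEquiv.apply_symm_apply]

lemma cubeDictionary_mem_dictionaries (ha : n * a ^ 2 ≤ 1) (θ : Fin p × Fin n → Bool) :
    cubeDictionary b a θ ∈ dictionaries (n + 1) p := by
  refine (mem_dictionaries_iff_sum_colCoord_sq b _).2 fun k => ?_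
  simp [colCoord_cubeDictionary, Fin.sum_univ_succ, Real.sq_sqrt (sub_nonneg.2 ha)]

lemma frobNorm_cubeDictionary_sub_sq_le {D₀ : Matrix (Fin (n + 1)) (Fin p) ℝ}
    (hD₀ : ∀ k, colCoord b D₀ k = Fin.cons 1 0) (ha : n * a ^ 2 ≤ 1) (θ : Fin p × Fin n → Bool) :
    frobNorm (cubeDictionary b a θ - D₀) ^ 2 ≤ 2 * (p * n * a ^ 2) := by
  set c := √(1 - n * a ^ 2)
  have hcol : ∀ k, ∑ i, colCoord b (cubeDictionary b a θ - D₀) k i ^ 2 =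
      (c - 1) ^ 2 + n * a ^ 2 := fun k => by
    simp [colCoord_cubeDictionary, Fin.sum_univ_succ, hD₀, c]
  have hc : (c - 1) ^ 2 + n * a ^ 2 ≤ 2 * (n * a ^ 2) := by
    have hc1 : c ≤ 1 := Real.sqrt_le_one.2 (by linarith [show 0 ≤ n * a ^ 2 by positivity])
    nlinarith [Real.sq_sqrt (sub_nonneg.2 ha), Real.sqrt_nonneg (1 - n * a ^ 2)]
  rw [frobNorm_sq_eq_sum_colCoord_sq b, Finset.sum_congr rfl fun k _ => hcol k]
  simp only [Finset.sum_const, Finset.card_univ, Fintype.card_fin, nsmul_eq_mul]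
  nlinarith [mul_le_mul_of_nonneg_left hc p.cast_nonneg]

lemma frobNorm_cubeDictionary_sub_update_sq (a : ℝ) (θ : Fin p × Fin n → Bool)
    (i : Fin p × Fin n) :
    frobNorm (cubeDictionary b a θ - cubeDictionary b a (Function.update θ i (!θ i))) ^ 2 =
      4 * a ^ 2 := by
  have hcoord : ∀ k j, colCoord b (cubeDictionary b a θ -
      cubeDictionary b a (Function.update θ i (!θ i))) k (Fin.succ j) ^ 2 =
        if (k, j) = i then 4 * a ^ 2 else 0 := fun k j => by
    by_cases hi : (k, j) = i
    · subst hi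
      cases h : θ (k, j) <;> simp [colCoord_cubeDictionary, h] <;> ring
    · simp [colCoord_cubeDictionary, hi]
  have hzero : ∀ k, colCoord b (cubeDictionary b a θ -
      cubeDictionary b a (Function.update θ i (!θ i))) k 0 = 0 := fun k => by
    simp [colCoord_cubeDictionary]
  rw [frobNorm_sq_eq_sum_colCoord_sq b]
  simp only [Fin.sum_univ_succ, hzero, hcoord, zero_pow two_ne_zero, zero_add]
  rw [← Fintype.sum_prod_type fun x => if x = i then 4 * a ^ 2 else 0, Fintype.sum_ite_eq']

lemma sum_sq_sub_le_frobNorm_sub_cubeDictionary_sq (a : ℝ) (θ : Fin p × Fin n → Bool)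
    (A : Matrix (Fin (n + 1)) (Fin p) ℝ) :
    ∑ i : Fin p × Fin n, (colCoord b A i.1 i.2.succ - if θ i then a else -a) ^ 2 ≤
      frobNorm (A - cubeDictionary b a θ) ^ 2 := by
  rw [frobNorm_sq_eq_sum_colCoord_sq b, Fintype.sum_prod_type]
  refine Finset.sum_le_sum fun k _ => ?_
  rw [Fin.sum_univ_succ]
  simp only [map_sub, Pi.sub_apply, colCoord_cubeDictionary, Fin.cons_succ]
  exact le_add_of_nonneg_left (sq_nonneg _)

end Hypercube

section Minimax

lemma card_mul_le_two_mul_iSup_sum_cube {κ : Type*} [Fintype κ] [DecidableEq κ]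
    (g : κ → (κ → Bool) → ℝ≥0∞) (c : ℝ≥0∞)
    (h : ∀ i θ, c ≤ g i θ + g i (Function.update θ i (!θ i))) :
    Fintype.card κ * c ≤ 2 * ⨆ θ, ∑ i, g i θ := by
  have haverage : ∀ i, Fintype.card (κ → Bool) * c ≤ 2 * ∑ θ, g i θ := fun i => by
    have hinv : Function.Involutive fun θ : κ → Bool => Function.update θ i (!θ i) := by
      intro θ; simp
    have hflip : ∑ θ, g i (Function.update θ i (!θ i)) = ∑ θ, g i θ :=
      Equiv.sum_comp hinv.toPerm (g i)
    calc Fintype.card (κ → Bool) * c = ∑ _θ : κ → Bool, c := by simp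
      _ ≤ ∑ θ, (g i θ + g i (Function.update θ i (!θ i))) := Finset.sum_le_sum fun θ _ => h i θ
      _ = 2 * ∑ θ, g i θ := by rw [Finset.sum_add_distrib, hflip, two_mul]
  refine (ENNReal.mul_le_mul_iff_right (a := Fintype.card (κ → Bool)) (by simp)
    (ENNReal.natCast_ne_top _)).1 ?_
  calc Fintype.card (κ → Bool) * (Fintype.card κ * c)
      = ∑ _i : κ, Fintype.card (κ → Bool) * c := by
        rw [Finset.sum_const, Finset.card_univ, nsmul_eq_mul, mul_left_comm]
    _ ≤ ∑ i, 2 * ∑ θ, g i θ := Finset.sum_le_sum fun i _ => haverage i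
    _ = 2 * ∑ θ, ∑ i, g i θ := by rw [← Finset.mul_sum, Finset.sum_comm]
    _ ≤ 2 * ∑ _θ : κ → Bool, ⨆ θ, ∑ i, g i θ := by
        gcongr with θ
        exact le_iSup (fun θ => ∑ i, g i θ) θ
    _ = Fintype.card (κ → Bool) * (2 * ⨆ θ, ∑ i, g i θ) := by
        rw [Finset.sum_const, Finset.card_univ, nsmul_eq_mul, mul_left_comm]

variable {n p N : ℕ} {P : Measure (Fin p → ℝ)} {σ a r : ℝ}

lemma edist_sq_eq_ofReal_sub_sq (x y : ℝ) : edist x y ^ 2 = ENNReal.ofReal ((x - y) ^ 2) := by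
  rw [edist_dist, ← ENNReal.ofReal_pow dist_nonneg, Real.dist_eq, sq_abs]

lemma sum_lintegral_edist_sq_le_mse
    (b : Fin p → OrthonormalBasis (Fin (n + 1)) ℝ (EuclideanSpace ℝ (Fin (n + 1)))) (a : ℝ)
    {Dhat : (Fin N → Fin (n + 1) → ℝ) → Matrix (Fin (n + 1)) (Fin p) ℝ}
    (hcoord : ∀ k i, Measurable fun Y => colCoord b (Dhat Y) k i) (θ : Fin p × Fin n → Bool) :
    ∑ i, ∫⁻ Y, edist (colCoord b (Dhat Y) i.1 i.2.succ) (if θ i then a else -a) ^ 2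
        ∂(dataLaw N P σ (cubeDictionary b a θ)) ≤ mse N P σ Dhat (cubeDictionary b a θ) := by
  rw [← lintegral_finsetSum _ fun i _ => by fun_prop]
  refine lintegral_mono fun Y => ?_
  simp only [edist_sq_eq_ofReal_sub_sq]
  rw [← ENNReal.ofReal_sum_of_nonneg fun i _ => sq_nonneg _]
  exact ENNReal.ofReal_le_ofReal (sum_sq_sub_le_frobNorm_sub_cubeDictionary_sq b a θ (Dhat Y))

lemma ofReal_sq_le_add_risk_flip [IsProbabilityMeasure P]
    (hP2 : ∀ i, MemLp (fun x : Fin p → ℝ => x i) 2 P) (hσ : σ ≠ 0)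
    (ha : 2 * a ^ 2 * (N * specNorm (covMat P)) ≤ σ ^ 2)
    (b : Fin p → OrthonormalBasis (Fin (n + 1)) ℝ (EuclideanSpace ℝ (Fin (n + 1))))
    {T : (Fin N → Fin (n + 1) → ℝ) → ℝ} (hT : Measurable T) (θ : Fin p × Fin n → Bool)
    (i : Fin p × Fin n) :
    ENNReal.ofReal (a ^ 2) ≤
      ∫⁻ Y, edist (T Y) (if θ i then a else -a) ^ 2 ∂(dataLaw N P σ (cubeDictionary b a θ)) +
        ∫⁻ Y, edist (T Y) (if Function.update θ i (!θ i) i then a else -a) ^ 2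
          ∂(dataLaw N P σ (cubeDictionary b a (Function.update θ i (!θ i)))) := by
  have hsep : edist (if θ i then a else -a) (if Function.update θ i (!θ i) i then a else -a) ^ 2 =
      4 * ENNReal.ofReal (a ^ 2) := by
    rw [edist_sq_eq_ofReal_sub_sq, ← ENNReal.ofReal_ofNat 4, ← ENNReal.ofReal_mul (by norm_num)]
    congr 1
    cases θ i <;> simp <;> ring
  have hclose : N * specNorm (covMat P) * frobNorm (cubeDictionary b a θ -
      cubeDictionary b a (Function.update θ i (!θ i))) ^ 2 ≤ 2 * σ ^ 2 := by
    rw [frobNorm_cubeDictionary_sub_update_sq]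
    linarith
  have h := two_point_dataLaw hP2 hσ hclose hT (if θ i then a else -a)
    (if Function.update θ i (!θ i) i then a else -a)
  rw [hsep] at h
  exact (ENNReal.mul_le_mul_iff_right (by norm_num) (by norm_num)).1 h

lemma ofReal_div_two_le_minimaxRisk [IsProbabilityMeasure P]
    (hP2 : ∀ i, MemLp (fun x : Fin p → ℝ => x i) 2 P) (hσ : σ ≠ 0)
    {D₀ : Matrix (Fin (n + 1)) (Fin p) ℝ} (hD₀ : D₀ ∈ dictionaries (n + 1) p) (hr : 0 < r)
    (han : n * a ^ 2 ≤ 1) (har : 4 * (p * n * a ^ 2) ≤ r ^ 2)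
    (haσ : 2 * a ^ 2 * (N * specNorm (covMat P)) ≤ σ ^ 2) :
    ENNReal.ofReal (p * n * a ^ 2 / 2) ≤ minimaxRisk N P σ D₀ r := by
  obtain ⟨b, hb⟩ := exists_colCoord_eq_cons_one_zero hD₀
  have hmem : ∀ θ, cubeDictionary b a θ ∈ localDictionaries D₀ r := fun θ =>
    ⟨cubeDictionary_mem_dictionaries b han θ, lt_of_pow_lt_pow_left₀ 2 hr.le <| by
      linarith [frobNorm_cubeDictionary_sub_sq_le b hb han θ, pow_pos hr 2]⟩
  refine le_iInf₂ fun Dhat hDhat => ?_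
  rw [ENNReal.ofReal_div_of_pos two_pos, ENNReal.ofReal_ofNat]
  refine ENNReal.div_le_of_le_mul' ?_
  have hcoord : ∀ k i, Measurable fun Y => colCoord b (Dhat Y) k i := fun k i => by
    simp only [colCoord_apply_eq_sum]
    fun_prop
  have hassouad := card_mul_le_two_mul_iSup_sum_cube (κ := Fin p × Fin n) _ _ fun i θ =>
    ofReal_sq_le_add_risk_flip hP2 hσ haσ b (hcoord i.1 i.2.succ) θ i
  calc ENNReal.ofReal (p * n * a ^ 2)
      = Fintype.card (Fin p × Fin n) * ENNReal.ofReal (a ^ 2) := by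
        rw [← ENNReal.ofReal_natCast, ← ENNReal.ofReal_mul (Nat.cast_nonneg _)]; simp
    _ ≤ _ := hassouad
    _ ≤ 2 * ⨆ D ∈ localDictionaries D₀ r, mse N P σ Dhat D := by
        gcongr
        exact iSup_le fun θ => (sum_lintegral_edist_sq_le_mse b a hcoord θ).trans
          (le_iSup₂ (f := fun D _ => mse N P σ Dhat D) _ (hmem θ))

lemma toReal_mul_le_of_le_ofReal_div_mul {x : ℝ≥0∞} (hx : x ≠ ⊤) {s k d : ℝ} (hs : 0 ≤ s)
    (hd : 0 ≤ d) (h : x ≤ ENNReal.ofReal s / ENNReal.ofReal k * ENNReal.ofReal d) :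
    x.toReal * k ≤ s * d := by
  refine (ENNReal.ofReal_le_ofReal_iff (mul_nonneg hs hd)).1 ?_
  rw [ENNReal.ofReal_mul ENNReal.toReal_nonneg, ENNReal.ofReal_toReal hx, ENNReal.ofReal_mul hs]
  rw [← ENNReal.mul_div_right_comm] at h
  exact ENNReal.mul_le_of_le_div h

lemma ofReal_div_eight_le_minimaxRisk [IsProbabilityMeasure P]
    (hP2 : ∀ i, MemLp (fun x : Fin p → ℝ => x i) 2 P) (hσ : σ ≠ 0)
    {D₀ : Matrix (Fin (n + 1)) (Fin p) ℝ} (hD₀ : D₀ ∈ dictionaries (n + 1) p) (hr : 0 < r)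
    (hrp : r ≤ 2 * √(p : ℝ)) (hn : 0 < n) {t : ℝ} (ht : 0 ≤ t) (htr : t ≤ r ^ 2)
    (htσ : t * (N * specNorm (covMat P)) ≤ 2 * (p * n) * σ ^ 2) :
    ENNReal.ofReal (t / 8) ≤ minimaxRisk N P σ D₀ r := by
  have hp : (0 : ℝ) < p := Real.sqrt_pos.1 (by linarith)
  have : (0 : ℝ) < n := Nat.cast_pos.2 hn
  have hr4 : r ^ 2 ≤ 4 * p := by
    calc r ^ 2 ≤ (2 * √p) ^ 2 := by gcongr
      _ = 4 * (p : ℝ) := by rw [mul_pow, Real.sq_sqrt hp.le]; norm_num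
  set a := √(t / (4 * (p * n)))
  have ha : a ^ 2 = t / (4 * (p * n)) := Real.sq_sqrt (by positivity)
  have hta : 4 * (p * n * a ^ 2) = t := by rw [ha]; field_simp
  have haσ : 2 * a ^ 2 * (N * specNorm (covMat P)) ≤ σ ^ 2 := by
    refine le_of_mul_le_mul_left (a := 2 * (p * n : ℝ)) ?_ (by positivity)
    calc 2 * (p * n) * (2 * a ^ 2 * (N * specNorm (covMat P)))
        = 4 * (p * n * a ^ 2) * (N * specNorm (covMat P)) := by ring
      _ ≤ 2 * (p * n) * σ ^ 2 := by rwa [hta]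
  have h := ofReal_div_two_le_minimaxRisk (a := a) hP2 hσ hD₀ hr
    (le_of_mul_le_mul_left (a := (p : ℝ)) (by linarith) hp) (hta.trans_le htr) haσ
  exact (ENNReal.ofReal_le_ofReal (by linarith)).trans h

end Minimax

end DictLearn

theorem theorem1_general {m p : ℕ} (N : ℕ)
    (P : MeasureTheory.Measure (Fin p → ℝ)) [MeasureTheory.IsProbabilityMeasure P]
    (hP2 : ∀ i, MeasureTheory.MemLp (fun x : Fin p → ℝ => x i) 2 P)
    (σ : ℝ) (hσ : 0 < σ)
    (D₀ : Matrix (Fin m) (Fin p) ℝ) (hD₀ : D₀ ∈ DictLearn.dictionaries m p)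
    (r : ℝ) (hr : 0 < r) (hrp : r ≤ 2 * √(p : ℝ)) :
    ENNReal.ofReal (1 / 8) *
        min (ENNReal.ofReal (r ^ 2))
          (ENNReal.ofReal (σ ^ 2) /
              ENNReal.ofReal ((N : ℝ) * DictLearn.specNorm (DictLearn.covMat P)) *
            ENNReal.ofReal (2 * ((p : ℝ) * ((m : ℝ) - 1))))
      ≤ DictLearn.minimaxRisk N P σ D₀ r := by
  rcases le_or_gt m 1 with hm | hm
  · have hdim : 2 * ((p : ℝ) * ((m : ℝ) - 1)) ≤ 0 :=
      mul_nonpos_of_nonneg_of_nonpos zero_le_two <|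
        mul_nonpos_of_nonneg_of_nonpos p.cast_nonneg (sub_nonpos.2 (mod_cast hm))
    simp [ENNReal.ofReal_of_nonpos hdim]
  obtain ⟨n, rfl⟩ := Nat.exists_eq_succ_of_ne_zero (Nat.ne_zero_of_lt hm)
  have hdim : 2 * ((p : ℝ) * ((n.succ : ℝ) - 1)) = 2 * (p * n) := by push_cast; ring
  rw [hdim]
  set t := min (ENNReal.ofReal (r ^ 2)) _
  have ht_top : t ≠ ⊤ := ne_top_of_le_ne_top ENNReal.ofReal_ne_top (min_le_left _ _)
  rw [← ENNReal.ofReal_toReal ht_top, ← ENNReal.ofReal_mul (by norm_num), one_div_mul_eq_div]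
  refine DictLearn.ofReal_div_eight_le_minimaxRisk hP2 hσ.ne' hD₀ hr hrp (Nat.lt_of_succ_lt_succ hm)
    ENNReal.toReal_nonneg (ENNReal.toReal_le_of_le_ofReal (sq_nonneg r) (min_le_left _ _)) ?_
  rw [mul_comm _ (σ ^ 2)]
  exact DictLearn.toReal_mul_le_of_le_ofReal_div_mul ht_top (sq_nonneg σ) (by positivity)
    (min_le_right _ _)

theorem theorem1 {m p : ℕ} (N : ℕ)
    (P : MeasureTheory.Measure (Fin p → ℝ)) [MeasureTheory.IsProbabilityMeasure P]
    (hP2 : ∀ i, MeasureTheory.MemLp (fun x : Fin p → ℝ => x i) 2 P)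
    (hP0 : ∀ i, ∫ x, x i ∂P = 0)
    (σ : ℝ) (hσ : 0 < σ)
    (D₀ : Matrix (Fin m) (Fin p) ℝ) (hD₀ : D₀ ∈ DictLearn.dictionaries m p)
    (r : ℝ) (hr : 0 < r) (hrp : r ≤ 2 * √(p : ℝ))
    (hmp : 50 ≤ (p : ℝ) * ((m : ℝ) - 1)) :
    -- Division is in `[0, ∞]`: the second term is `∞` (so that the bound is `r² / 320`)
    -- if there are no observations or if the coefficient vector vanishes almost surely.
    ENNReal.ofReal (1 / 320) *
        min (ENNReal.ofReal (r ^ 2))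
          (ENNReal.ofReal (σ ^ 2) /
              ENNReal.ofReal ((N : ℝ) * DictLearn.specNorm (DictLearn.covMat P)) *
            ENNReal.ofReal ((p : ℝ) * ((m : ℝ) - 1) / 10 - 1))
      ≤ DictLearn.minimaxRisk N P σ D₀ r := by
  refine le_trans ?_ (theorem1_general N P hP2 σ hσ D₀ hD₀ r hr hrp)
  gcongr <;> linarith
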